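/- For integers $n,m\ge 0$ let $\mathrm{IMS2}(n,m)$ be the set of arrays $A[0..n-1][0..n-1]$ of integers with $0\le A[i][j]<m$ for all $i,j$, $A[i][j]\le A[i][j+1]$ for $0\le i<n$, $0\le j<n-1$, and $A[i][j]\le A[i+1][j]$ for $0\le i<n-1$, $0\le j<n$. Put $A[-1][\cdot]=A[\cdot][-1]=-1$ and $A[n][\cdot]=A[\cdot][n]=+\infty$. For $0\le k<m$ the $k$-th boundary of $A$ is the set of edges of the $(n+1)\times(n+1)$ grid graph $$\{((i,j),(i+1,j)) : A[i][j-1]<k\le A[i][j]\}\ \cup\ \{((i,j),(i,j+1)) : A[i-1][j]<k\le A[i][j]\},$$ where $0\le i<n$, $0\le j\le n$ in the first set and $0\le i\le n$, $0\le j<n$ in the second. It is a path from $(0,n)$ to $(n,0)$ with steps $(i,j)\to(i+1,j)$ and $(i,j)\to(i,j-1)$. Its bit-vector $B_k\in\{0,1\}^{2n}$ records the steps in this order, $1$ for $(i,j)\to(i+1,j)$ and $0$ for $(i,j)\to(i,j-1)$. The model is a word RAM with words of $w=\Theta(\log(nm))$ bits. Unit-cost instructions are loading a constant, the arithmetic operations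 $+,-,\cdot,\div,\bmod$, bitwise and, or, xor, shifts, reading a memory word, and (conditional) jumps. The space of a data structure is the number of its memory words times $w$. **Theorem.** For every $A\in\mathrm{IMS2}(n,m)$ there exists a data structure of $O(nm)$ bits that stores the bit-vectors $B_0,\dots,B_{m-1}$ of the $m$ boundaries and supports deciding, given $i,j,k$, whether $A[i][j]\ge k$ in constant time. Precisely: let $\ell=\lfloor\log_2 \max(nm,1)\rfloor+1$. There are a fixed program $P$ and constants $T,d$ such that for every $c$ there is a constant $C$ with the following property. For all $n,m$, all $w$ with $\ell+d\le w\le c\,\ell$, and all $A\in\mathrm{IMS2}(n,m)$, there is a sequence $D$ of $w$-bit words, of at most $C\,nm$ bits in total, that contains the concatenation $B_0B_1\cdots B_{m-1}$ as a contiguous block of bits, and such that $P$, with $D$ as its memory and with $i,j,k$ as input ($0\le i,j<n$ and $0\le k<2^w$), halts after at most $T$ steps with output $1$ if $A[i][j]\ge k$ and $0$ otherwise. -/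

import Mathlib

namespace WordRAM

/-- Binary operations on machine words, all of unit cost. Arithmetic is modulo `2 ^ w`, division is
integer division of unsigned words, and `shl`, `shr` are logical shifts. -/
inductive BinOp where
  | add | sub | mul | div | mod | and | or | xor | shl | shr

def BinOp.eval {w : ℕ} : BinOp → BitVec w → BitVec w → BitVec w
  | .add, x, y => x + y
  | .sub, x, y => x - y
  | .mul, x, y => x * y
  | .div, x, y => x / y
  | .mod, x, y => x % y
  | .and, x, y => x &&& y
  | .or, x, y => x ||| y
  | .xor, x, y => x ^^^ y
  | .shl, x, y => x <<< y.toNat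
  | .shr, x, y => x >>> y.toNat

/-- Instructions of the machine; natural numbers name registers, except that `v` is a numeral and
`l` is the index of an instruction of the program. -/
inductive Instr where
  /-- `r := v` (modulo `2 ^ w`) -/
  | const (r v : ℕ)
  /-- `r := a op b` -/
  | bin (op : BinOp) (r a b : ℕ)
  /-- `r := memory[a]` -/
  | load (r a : ℕ)
  /-- go to `l` -/
  | jmp (l : ℕ)
  /-- if `a < b` (unsigned) go to `l` -/
  | jlt (a b l : ℕ)
  /-- if `a = b` go to `l` -/
  | jeq (a b l : ℕ)

abbrev Program := List Instr

/-- A configuration: the program counter and the contents of the registers. -/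
structure Config (w : ℕ) where
  pc : ℕ
  reg : ℕ → BitVec w

/-- The effect of one instruction, with read-only memory `D`
(addresses beyond its end read as `0`). -/
def Instr.exec {w : ℕ} (D : List (BitVec w)) (s : Config w) : Instr → Config w
  | .const r v => ⟨s.pc + 1, Function.update s.reg r (BitVec.ofNat w v)⟩
  | .bin op r a b => ⟨s.pc + 1, Function.update s.reg r (op.eval (s.reg a) (s.reg b))⟩
  | .load r a => ⟨s.pc + 1, Function.update s.reg r (D.getD (s.reg a).toNat 0)⟩
  | .jmp l => ⟨l, s.reg⟩
  | .jlt a b l => ⟨if (s.reg a).toNat < (s.reg b).toNat then l else s.pc + 1, s.reg⟩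
  | .jeq a b l => ⟨if s.reg a = s.reg b then l else s.pc + 1, s.reg⟩

/-- One step of the machine. It has halted once there is no instruction at the program counter. -/
def step {w : ℕ} (P : Program) (D : List (BitVec w)) (s : Config w) : Config w :=
  match P[s.pc]? with
  | none => s
  | some I => I.exec D s

/-- The start of a query: the arguments are in registers `0`, `1`, `2`; all other registers
are `0`. -/
def initial {w : ℕ} (x y z : BitVec w) : Config w :=
  ⟨0, fun r => if r = 0 then x else if r = 1 then y else if r = 2 then z else 0⟩

/-- On memory `D` and arguments `x`, `y`, `z` the program `P` halts after at most `T` steps with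
the word `out` in register `0`. -/
def Answers {w : ℕ} (P : Program) (T : ℕ) (D : List (BitVec w)) (x y z out : BitVec w) : Prop :=
  ∃ t ≤ T, P.length ≤ ((step P D)^[t] (initial x y z)).pc ∧
    ((step P D)^[t] (initial x y z)).reg 0 = out

/-- The bits of the memory, word after word, least significant bit first. -/
def bits {w : ℕ} (D : List (BitVec w)) : List Bool :=
  D.flatMap fun x => List.ofFn fun t : Fin w => x.getLsbD t

end WordRAM

/-- `A` is an `n × n` array with entries in `{0, …, m - 1}` that increases weakly along both
indices. -/
structure IMS2 (n m : ℕ) (A : Fin n → Fin n → ℕ) : Prop where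
  le_next_right : ∀ i j j' : Fin n, (j' : ℕ) = j + 1 → A i j ≤ A i j'
  le_next_down : ∀ i i' j : Fin n, (i' : ℕ) = i + 1 → A i j ≤ A i' j
  lt : ∀ i j, A i j < m

namespace IMS2

/-- The array with `-1` in row and column `-1`, and `∞` in row and column `n`. -/
def extend {n : ℕ} (A : Fin n → Fin n → ℕ) (x y : ℤ) : WithTop ℤ :=
  if x < 0 ∨ y < 0 then ((-1 : ℤ) : WithTop ℤ)
  else if h : x.toNat < n ∧ y.toNat < n then ((A ⟨x.toNat, h.1⟩ ⟨y.toNat, h.2⟩ : ℤ) : WithTop ℤ)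
  else ⊤

/-- The `k`-th boundary: a set of edges of the grid graph on `{0, …, n} × {0, …, n}`, which
separates the entries `< k` from the entries `≥ k`. The entry `A i j` is the unit square with
corners `(i, j)` and `(i + 1, j + 1)`. -/
def boundary {n : ℕ} (A : Fin n → Fin n → ℕ) (k : ℕ) : Set ((ℕ × ℕ) × (ℕ × ℕ)) :=
  {e | ∃ i j : ℕ, i < n ∧ j ≤ n ∧ e = ((i, j), (i + 1, j)) ∧
      extend A i (j - 1) < ((k : ℤ) : WithTop ℤ) ∧ ((k : ℤ) : WithTop ℤ) ≤ extend A i j} ∪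
  {e | ∃ i j : ℕ, i ≤ n ∧ j < n ∧ e = ((i, j), (i, j + 1)) ∧
      extend A (i - 1) j < ((k : ℤ) : WithTop ℤ) ∧ ((k : ℤ) : WithTop ℤ) ≤ extend A i j}

open Classical in
/-- Follow the edges of `E` for `t` steps from a vertex `(i, j)`: write `1` for a step
to `(i + 1, j)` and `0` for a step to `(i, j - 1)`. -/
noncomputable def traverse (E : Set ((ℕ × ℕ) × (ℕ × ℕ))) : ℕ → ℕ → ℕ → List Bool
  | 0, _, _ => []
  | t + 1, i, j =>
    if ((i, j), (i + 1, j)) ∈ E then true :: traverse E t (i + 1) j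
    else false :: traverse E t i (j - 1)

/-- The bit-vector of length `2 n` of the `k`-th boundary, which is a monotone lattice path
from `(0, n)` to `(n, 0)`. -/
noncomputable def boundaryCode {n : ℕ} (A : Fin n → Fin n → ℕ) (k : ℕ) : List Bool :=
  traverse (boundary A k) (2 * n) 0 n

end IMS2

/-! Every vertex `(x, y)` of the `k`-th boundary separates: entries above and left of it are `< k`,
entries below and right are `≥ k`. After `t = n + i - j` steps the path is at a vertex with `x - y =
i - j`, so either `x ≤ i` and `y ≤ j`, or `i < x` and `j < y`. Hence `k ≤ A i j` iff the first `t`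
bits of `B_k` contain at most `i` ones (`le_iff_bitRank_boundaryCode_le`). Each `B_k` has exactly
`n` ones, so the query is a single rank query in the concatenation, at position `2nk + t`, compared
with `nk + i` (`bitRank_allCodes`).

Rank takes constant time with one full-word sample every `b` bits inside each word, `b` being about
`ℓ / 2`, and a table of the popcounts of all `b`-bit numbers (`word_add_word_rankMemory`). Since `w
≤ c ℓ`, there are `O(c)` samples per word of the bit-vector, so the samples take `O(nm)` bits. The
table has about `√(nm)` words, which is also `O(nm)` bits. -/

namespace IMS2

/-! ### Boundary vertices separate small entries from large ones. -/

variable {n m : ℕ} {A : Fin n → Fin n → ℕ}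

theorem mono_right (hA : IMS2 n m A) (i j j' : Fin n) (h : j ≤ j') : A i j ≤ A i j' := by
  obtain ⟨j', hj'⟩ := j'
  induction j' with
  | zero => exact le_of_eq (congrArg _ (Fin.ext (Nat.le_zero.1 h)))
  | succ y ih =>
    rcases (Fin.le_def.1 h).lt_or_eq with h | h
    · exact (ih (by omega) (Fin.le_def.2 (Nat.lt_succ_iff.1 h))).trans
        (hA.le_next_right _ _ _ rfl)
    · exact le_of_eq (congrArg _ (Fin.ext h))

theorem mono_down (hA : IMS2 n m A) (i i' j : Fin n) (h : i ≤ i') : A i j ≤ A i' j := by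
  obtain ⟨i', hi'⟩ := i'
  induction i' with
  | zero => exact le_of_eq (congrArg (A · j) (Fin.ext (Nat.le_zero.1 h)))
  | succ y ih =>
    rcases (Fin.le_def.1 h).lt_or_eq with h | h
    · exact (ih (by omega) (Fin.le_def.2 (Nat.lt_succ_iff.1 h))).trans
        (hA.le_next_down _ _ _ rfl)
    · exact le_of_eq (congrArg (A · j) (Fin.ext h))

theorem extend_inside (i j : Fin n) : extend A (i : ℕ) (j : ℕ) = ((A i j : ℤ) : WithTop ℤ) := by
  simp [extend]

/-- The border values `-1` and `∞` make the edge conditions vacuous outside the array. -/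
theorem extend_lt_iff {i j k : ℕ} (hi : i < n) (hj : j ≤ n) :
    extend A i ((j : ℤ) - 1) < ((k : ℤ) : WithTop ℤ) ↔
      ∀ h : 0 < j, A ⟨i, hi⟩ ⟨j - 1, by omega⟩ < k := by
  rcases Nat.eq_zero_or_pos j with rfl | h
  · have : extend A i (((0 : ℕ) : ℤ) - 1) = ((-1 : ℤ) : WithTop ℤ) := by simp [extend]
    rw [this, WithTop.coe_lt_coe]
    exact ⟨fun _ h => absurd h (lt_irrefl 0), fun _ => by omega⟩
  · have e : ((j : ℤ) - 1) = ((j - 1 : ℕ) : ℤ) := by omega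
    rw [e, extend_inside ⟨i, hi⟩ ⟨j - 1, by omega⟩, WithTop.coe_lt_coe, Nat.cast_lt]
    exact ⟨fun h _ => h, fun h' => h' h⟩

theorem le_extend_iff {i j k : ℕ} (hi : i < n) :
    ((k : ℤ) : WithTop ℤ) ≤ extend A i j ↔ ∀ h : j < n, k ≤ A ⟨i, hi⟩ ⟨j, h⟩ := by
  by_cases h : j < n
  · rw [extend_inside ⟨i, hi⟩ ⟨j, h⟩, WithTop.coe_le_coe, Nat.cast_le]
    exact ⟨fun h _ => h, fun h' => h' h⟩
  · have : extend A i j = ⊤ := by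
      simp [extend, h]
    rw [this]
    exact ⟨fun _ h' => absurd h' h, fun _ => le_top⟩

theorem down_mem_boundary {k i j : ℕ} (hj : j ≤ n) :
    ((i, j), (i + 1, j)) ∈ boundary A k ↔ ∃ hi : i < n,
      (∀ h : 0 < j, A ⟨i, hi⟩ ⟨j - 1, by omega⟩ < k) ∧ ∀ h : j < n, k ≤ A ⟨i, hi⟩ ⟨j, h⟩ := by
  constructor
  · rintro (⟨i', j', hi, -, he, h1, h2⟩ | ⟨i', j', -, -, he, -, -⟩)
    · simp only [Prod.mk.injEq] at he
      obtain ⟨⟨rfl, rfl⟩, -⟩ := he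
      exact ⟨hi, (extend_lt_iff hi hj).1 h1, (le_extend_iff hi).1 h2⟩
    · simp only [Prod.mk.injEq] at he
      omega
  · rintro ⟨hi, h1, h2⟩
    exact Or.inl ⟨i, j, hi, hj, rfl, (extend_lt_iff hi hj).2 h1, (le_extend_iff hi).2 h2⟩

/-- The vertex `(x, y)` separates the entries `< k` from the entries `≥ k`: so do the vertices on
the `k`-th boundary. -/
structure Separates (A : Fin n → Fin n → ℕ) (k x y : ℕ) : Prop where
  le_row : x ≤ n
  le_col : y ≤ n
  lt : ∀ i j : Fin n, (i : ℕ) < x → (j : ℕ) < y → A i j < k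
  le : ∀ i j : Fin n, x ≤ (i : ℕ) → y ≤ (j : ℕ) → k ≤ A i j

/-- By monotonicity, `A x (y - 1)` is the largest entry of the enlarged upper left block, and the
edge condition makes it `< k`. -/
theorem Separates.down {k x y : ℕ} (hA : IMS2 n m A) (h : Separates A k x y)
    (he : ((x, y), (x + 1, y)) ∈ boundary A k) : Separates A k (x + 1) y := by
  obtain ⟨hx, h1, -⟩ := (down_mem_boundary h.le_col).1 he
  refine ⟨hx, h.le_col, fun i j hi hj => ?_, fun i j hi hj => h.le i j (by omega) hj⟩
  have := h.le_col
  refine (mono_down hA i ⟨x, hx⟩ j (Fin.le_def.2 (Nat.lt_succ_iff.1 hi))).trans_lt ?_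
  refine (mono_right hA _ j ⟨y - 1, by omega⟩ (Fin.le_def.2 (Nat.le_sub_one_of_lt hj))).trans_lt
    (h1 (by omega))

/-- For `x < n` the half `k ≤ A x y` of the edge condition follows from separation, so a missing
edge means `0 < y` and `k ≤ A x (y - 1)`, the least entry of the enlarged lower right block. For `x
= n` that block is empty. The hypothesis `hxy` excludes the end `(n, 0)`. -/
theorem Separates.left {k x y : ℕ} (hA : IMS2 n m A) (h : Separates A k x y)
    (he : ((x, y), (x + 1, y)) ∉ boundary A k) (hxy : x < n ∨ 0 < y) :
    0 < y ∧ Separates A k x (y - 1) := by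
  rw [down_mem_boundary h.le_col] at he
  by_cases hx : x < n
  · have h2 : ∃ h' : 0 < y, k ≤ A ⟨x, hx⟩ ⟨y - 1, by have := h.le_col; omega⟩ := by
      by_contra hc
      push Not at hc
      exact he ⟨hx, hc, fun h' => h.le _ _ le_rfl le_rfl⟩
    obtain ⟨hy, h2⟩ := h2
    refine ⟨hy, h.le_row, by have := h.le_col; omega,
      fun i j hi hj => h.lt i j hi (by omega), fun i j hi hj => h2.trans ?_⟩
    exact (mono_down hA _ i _ (Fin.le_def.2 hi)).trans (mono_right hA _ _ _ (Fin.le_def.2 hj))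
  · refine ⟨by omega, h.le_row, by have := h.le_col; omega,
      fun i j hi hj => h.lt i j hi (by omega), fun i j hi hj => absurd i.2 (by omega)⟩

end IMS2

/-- The number of ones among the first `p` bits of `l`. -/
def bitRank (l : List Bool) (p : ℕ) : ℕ := Nat.count (fun t => l.getD t false = true) p

theorem bitRank_cons_succ (a : Bool) (l : List Bool) (p : ℕ) :
    bitRank (a :: l) (p + 1) = bitRank l p + if a = true then 1 else 0 := by
  simp [bitRank, Nat.count_succ']

/-! ### Queries as ranks in the bit-vectors. -/

namespace IMS2

variable {n m : ℕ} {A : Fin n → Fin n → ℕ}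

theorem length_traverse (E : Set ((ℕ × ℕ) × (ℕ × ℕ))) (T x y : ℕ) :
    (traverse E T x y).length = T := by
  induction T generalizing x y with
  | zero => rfl
  | succ T ih => rw [traverse]; split <;> simp [ih]

theorem length_boundaryCode (k : ℕ) : (boundaryCode A k).length = 2 * n :=
  length_traverse _ _ _ _

/-- Each step preserves separation, and ones count the steps down. By `hT` the remaining steps just
suffice to reach `(n, 0)`, so the path is not yet there while steps remain. -/
theorem exists_separates_traverse {k T x y : ℕ} (hA : IMS2 n m A) (h : Separates A k x y)
    (hT : x + T = n + y) {t : ℕ} (ht : t ≤ T) :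
    ∃ y', Separates A k (x + bitRank (traverse (boundary A k) T x y) t) y' ∧
      bitRank (traverse (boundary A k) T x y) t + y = t + y' := by
  induction T generalizing x y t with
  | zero =>
    obtain rfl : t = 0 := by omega
    exact ⟨y, by simpa [bitRank] using h, by simp [bitRank]⟩
  | succ T ih =>
    rcases t with - | t
    · exact ⟨y, by simpa [bitRank] using h, by simp [bitRank]⟩
    rw [traverse]
    split_ifs with he
    · obtain ⟨y', h1, h2⟩ := ih (h.down hA he) (by omega) (t := t) (by omega)
      rw [bitRank_cons_succ, if_pos rfl]
      exact ⟨y', by convert h1 using 1; omega, by omega⟩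
    · obtain ⟨hy, hs⟩ := h.left hA he (by have := h.le_row; omega)
      obtain ⟨y', h1, h2⟩ := ih hs (by omega) (t := t) (by omega)
      rw [bitRank_cons_succ, if_neg (by simp)]
      exact ⟨y', h1, by omega⟩

theorem exists_separates_boundaryCode (hA : IMS2 n m A) (k : ℕ) {t : ℕ} (ht : t ≤ 2 * n) :
    ∃ y, Separates A k (bitRank (boundaryCode A k) t) y ∧
      bitRank (boundaryCode A k) t + n = t + y := by
  have h : Separates A k 0 n :=
    ⟨by omega, le_rfl, fun i j hi => absurd hi (by omega), fun i j _ hj => absurd j.2 (by omega)⟩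
  simpa [boundaryCode] using exists_separates_traverse hA h (T := 2 * n) (by omega) ht

/-- After `2n` steps `x = n + y`, while `x ≤ n`. -/
theorem bitRank_boundaryCode_two_mul (hA : IMS2 n m A) (k : ℕ) :
    bitRank (boundaryCode A k) (2 * n) = n := by
  obtain ⟨y, h1, h2⟩ := exists_separates_boundaryCode hA k le_rfl
  have := h1.le_row
  omega

/-- The boundary meets the diagonal through the entry `A i j` after `n + i - j` steps, so the
number of downward steps before tells on which side of the boundary the entry is. -/
theorem le_iff_bitRank_boundaryCode_le (hA : IMS2 n m A) (k : ℕ) (i j : Fin n) :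
    k ≤ A i j ↔ bitRank (boundaryCode A k) (n + i - j) ≤ i := by
  obtain ⟨y, h1, h2⟩ := exists_separates_boundaryCode hA k (t := n + i - j) (by omega)
  constructor
  · intro h
    by_contra! hc
    exact absurd (h1.lt i j hc (by omega)) (by omega)
  · exact fun h => h1.le i j h (by omega)

/-- The bit-vectors of the `m` boundaries, one after the other. -/
noncomputable def allCodes (m : ℕ) (A : Fin n → Fin n → ℕ) : List Bool :=
  (List.ofFn fun k : Fin m => boundaryCode A k).flatten

end IMS2

theorem List.getD_flatten_of_length_eq {α : Type*} {L : List (List α)} {c : ℕ}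
    (hL : ∀ l ∈ L, l.length = c) {k : ℕ} (hk : k < L.length) {t : ℕ} (ht : t < c) (d : α) :
    L.flatten.getD (c * k + t) d = L[k].getD t d := by
  induction L generalizing k with
  | nil => simp at hk
  | cons l L ih =>
    have hl : l.length = c := hL l (by simp)
    rcases k with - | k
    · rw [List.flatten_cons, List.getD_append _ _ _ _ (by omega)]
      simp
    · rw [List.flatten_cons, List.getD_append_right _ _ _ _ (by rw [hl]; nlinarith),
        show c * (k + 1) + t - l.length = c * k + t by rw [hl, mul_add, mul_one]; omega,
        ih (fun l' hl' => hL l' (by simp [hl'])) (by simpa using hk)]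
      simp

namespace IMS2

variable {n m : ℕ} {A : Fin n → Fin n → ℕ}

theorem length_allCodes : (allCodes m A).length = 2 * n * m := by
  simp [allCodes, List.length_flatten, Function.comp_def, length_boundaryCode, mul_comm]

theorem bitRank_allCodes (hA : IMS2 n m A) {k t : ℕ} (hk : k < m) (ht : t ≤ 2 * n) :
    bitRank (allCodes m A) (2 * n * k + t) = n * k + bitRank (boundaryCode A k) t := by
  have key : ∀ k t, k < m → t ≤ 2 * n → bitRank (allCodes m A) (2 * n * k + t) =
      bitRank (allCodes m A) (2 * n * k) + bitRank (boundaryCode A k) t := by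
    intro k t hk ht
    rw [bitRank, Nat.count_add]
    refine congrArg₂ _ rfl ?_
    refine le_antisymm ?_ ?_
    all_goals
      refine Nat.count_mono_left fun s hs => ?_
      rw [allCodes, List.getD_flatten_of_length_eq (by simp [length_boundaryCode])
        (by simpa using hk) (by omega)]
      simp
  rw [key k t hk ht]
  congr 1
  clear ht t
  induction k with
  | zero => simp [bitRank]
  | succ k ih =>
    rw [mul_add, mul_one, key k (2 * n) (by omega) le_rfl, ih (by omega),
      bitRank_boundaryCode_two_mul hA]
    ring

end IMS2

/-! ### The query program and its execution. -/

namespace WordRAM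

open BinOp Instr in
/-- Decide `A i j ≥ k` for `i`, `j`, `k` in registers `0`, `1`, `2`. The memory begins with `n`,
`m`, the word length, the number of bits between two rank samples, the number of rank samples per
word, the address of the first rank sample and the address of the popcount table; then come the
bit-vectors. -/
def queryProgram : Program :=
  [const 3 1, load 4 3, jlt 2 4 4, jmp 43,
   load 5 5, const 6 2, load 6 6, const 7 3, load 7 7, const 8 4, load 8 8, const 9 5, load 9 9,
   const 10 6, load 10 10,
   bin mul 11 5 2, bin add 12 11 11, bin add 12 12 5, bin add 12 12 0, bin sub 12 12 1,
   bin add 11 11 0,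
   bin div 13 12 6, bin mod 14 12 6, bin div 15 14 7, bin mod 16 14 7, bin sub 14 14 16,
   bin mul 17 13 8, bin add 17 17 15, bin add 17 17 9, load 17 17,
   const 18 7, bin add 13 13 18, load 13 13, bin shr 13 13 14, bin shl 18 3 16, bin sub 18 18 3,
   bin and 13 13 18, bin add 13 13 10, load 13 13, bin add 17 17 13,
   jlt 11 17 43, const 0 1, jmp 44, const 0 0]

variable {w : ℕ} (D : List (BitVec w))

/-- The registers after an instruction other than a jump. -/
def Instr.write (g : ℕ → BitVec w) : Instr → ℕ → BitVec w
  | .const r v => Function.update g r (BitVec.ofNat w v)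
  | .bin op r a b => Function.update g r (op.eval (g a) (g b))
  | .load r a => Function.update g r (D.getD (g a).toNat 0)
  | _ => g

/-- Whether an instruction is not a jump. -/
def Instr.isPlain : Instr → Bool
  | .const _ _ | .bin _ _ _ _ | .load _ _ => true
  | _ => false

/-- Jump-free code acts as a fold over its instructions, which lets the long middle of the program
be evaluated block by block. -/
theorem iterate_step_plain {P : Program} (L R : List Instr) (hL : ∀ I ∈ L, I.isPlain = true)
    {pc : ℕ} (hP : P.drop pc = L ++ R) (g : ℕ → BitVec w) :
    (step P D)^[L.length] ⟨pc, g⟩ = ⟨pc + L.length, L.foldl (Instr.write D) g⟩ := by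
  induction L generalizing pc g with
  | nil => rfl
  | cons I L ih =>
    have hI : P[pc]? = some I := by
      have := congrArg (·[0]?) hP
      simpa using this
    have hs : step P D ⟨pc, g⟩ = ⟨pc + 1, Instr.write D g I⟩ := by
      have := hL I (by simp)
      rw [step]
      simp only [hI]
      cases I <;> first | rfl | simp [Instr.isPlain] at this
    rw [List.length_cons, Function.iterate_succ_apply, hs,
      ih (fun J hJ => hL J (by simp [hJ])) (by rw [← List.drop_drop, hP]; rfl)]
    simp [add_comm, add_left_comm]

theorem answers_of_le {x y z m : BitVec w} (hw : 3 ≤ w) (hm : D.getD 1 0 = m)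
    (h : m.toNat ≤ z.toNat) :
    Answers queryProgram 45 D x y z 0#w := by
  have h1 : 1 % 2 ^ w = 1 := Nat.mod_eq_of_lt (Nat.one_lt_two_pow (by omega))
  refine ⟨5, by omega, ?_⟩
  have h' : ¬ z.toNat < (D[1]?.getD 0#w).toNat := by simpa [← hm] using h
  simp [Function.iterate_succ_apply, step, queryProgram, initial, Instr.exec, h1, h']

/-- The word at address `a`. -/
def word (a : BitVec w) : BitVec w := D.getD a.toNat 0

/-- The first load uses register `5` as its own address, which `h5` makes `0`. -/
theorem iterate_step_header (hw : 3 ≤ w) (g : ℕ → BitVec w) (h5 : g 5 = 0) :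
    ∃ g', (step queryProgram D)^[11] ⟨4, g⟩ = ⟨15, g'⟩ ∧ g' 0 = g 0 ∧ g' 1 = g 1 ∧ g' 2 = g 2 ∧
      g' 3 = g 3 ∧ g' 5 = D.getD 0 0 ∧ g' 6 = D.getD 2 0 ∧ g' 7 = D.getD 3 0 ∧
      g' 8 = D.getD 4 0 ∧ g' 9 = D.getD 5 0 ∧ g' 10 = D.getD 6 0 := by
  have e : ∀ v, v < 8 → v % 2 ^ w = v := fun v hv =>
    Nat.mod_eq_of_lt (hv.trans_le (Nat.pow_le_pow_right (n := 2) (by omega) hw))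
  refine ⟨_, iterate_step_plain D ((queryProgram.drop 4).take 11) (queryProgram.drop 15)
    (by decide) rfl g, ?_⟩
  simp [queryProgram, Instr.write, h5, e]

theorem iterate_step_position (g : ℕ → BitVec w) :
    ∃ g', (step queryProgram D)^[6] ⟨15, g⟩ = ⟨21, g'⟩ ∧ g' 3 = g 3 ∧ g' 6 = g 6 ∧ g' 7 = g 7 ∧
      g' 8 = g 8 ∧ g' 9 = g 9 ∧ g' 10 = g 10 ∧ g' 11 = g 5 * g 2 + g 0 ∧
      g' 12 = g 5 * g 2 + g 5 * g 2 + g 5 + g 0 - g 1 := by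
  refine ⟨_, iterate_step_plain D ((queryProgram.drop 15).take 6) (queryProgram.drop 21)
    (by decide) rfl g, ?_⟩
  simp [queryProgram, Instr.write, BinOp.eval]

theorem iterate_step_sample (g : ℕ → BitVec w) :
    ∃ g', (step queryProgram D)^[9] ⟨21, g⟩ = ⟨30, g'⟩ ∧ g' 3 = g 3 ∧ g' 10 = g 10 ∧
      g' 11 = g 11 ∧ g' 13 = g 12 / g 6 ∧ g' 14 = g 12 % g 6 - g 12 % g 6 % g 7 ∧
      g' 16 = g 12 % g 6 % g 7 ∧
      g' 17 = word D (g 12 / g 6 * g 8 + g 12 % g 6 / g 7 + g 9) := by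
  refine ⟨_, iterate_step_plain D ((queryProgram.drop 21).take 9) (queryProgram.drop 30)
    (by decide) rfl g, ?_⟩
  simp [queryProgram, Instr.write, BinOp.eval, word]

theorem iterate_step_popcount (g : ℕ → BitVec w) :
    ∃ g', (step queryProgram D)^[10] ⟨30, g⟩ = ⟨40, g'⟩ ∧ g' 11 = g 11 ∧
      g' 17 = g 17 + word D (((word D (g 13 + 7#w) >>> (g 14).toNat) &&&
        ((g 3 <<< (g 16).toNat) - g 3)) + g 10) := by
  refine ⟨_, iterate_step_plain D ((queryProgram.drop 30).take 10) (queryProgram.drop 40)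
    (by decide) rfl g, ?_⟩
  simp [queryProgram, Instr.write, BinOp.eval, word]

theorem answers_of_lt {x y z n m u b S R Q : BitVec w} (hw : 3 ≤ w)
    (h0 : D.getD 0 0 = n) (h1 : D.getD 1 0 = m) (h2 : D.getD 2 0 = u) (h3 : D.getD 3 0 = b)
    (h4 : D.getD 4 0 = S) (h5 : D.getD 5 0 = R) (h6 : D.getD 6 0 = Q) (h : z.toNat < m.toNat)
    {q p a o s r : BitVec w} (hq : q = n * z + x) (hp : p = n * z + n * z + n + x - y)
    (ha : a = p / u) (ho : o = p % u) (hs : s = o / b) (hr : r = o % b)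
    {c : BitVec w}
    (hc : c = word D (a * S + s + R) + word D
      (((word D (a + 7#w) >>> (o - r).toNat) &&& ((1#w <<< r.toNat) - 1#w)) + Q)) :
    Answers queryProgram 45 D x y z (if c.toNat ≤ q.toNat then 1#w else 0#w) := by
  have e : 1 % 2 ^ w = 1 := Nat.mod_eq_of_lt (Nat.one_lt_two_pow (by omega))
  -- The block lengths appear in reverse order of execution; the final comparison is at instruction
  -- `40`.
  obtain ⟨g, hg, h11, h17⟩ : ∃ g, (step queryProgram D)^[10 + 9 + 6 + 11 + 3] (initial x y z) =
      ⟨40, g⟩ ∧ g 11 = q ∧ g 17 = c := by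
    obtain ⟨g₁, e₁, i0, i1, i2, i3, i5⟩ : ∃ g, (step queryProgram D)^[3] (initial x y z) = ⟨4, g⟩ ∧
        g 0 = x ∧ g 1 = y ∧ g 2 = z ∧ g 3 = 1#w ∧ g 5 = 0 := by
      refine ⟨Function.update (Function.update (initial x y z).reg 3 1#w) 4 m, ?_⟩
      have h' : D[1]?.getD 0#w = m := by simpa using h1
      simp [Function.iterate_succ_apply, step, queryProgram, initial, Instr.exec, h', e, h]
    obtain ⟨g₂, e₂, j0, j1, j2, j3, j5, j6, j7, j8, j9, j10⟩ := iterate_step_header D hw g₁ i5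
    obtain ⟨g₃, e₃, k3, k6, k7, k8, k9, k10, k11, k12⟩ := iterate_step_position D g₂
    obtain ⟨g₄, e₄, l3, l10, l11, l13, l14, l16, l17⟩ := iterate_step_sample D g₃
    obtain ⟨g₅, e₅, m11, m17⟩ := iterate_step_popcount D g₄
    refine ⟨g₅, ?_, ?_, ?_⟩
    · rw [Function.iterate_add_apply, e₁, Function.iterate_add_apply, e₂,
        Function.iterate_add_apply, e₃, Function.iterate_add_apply, e₄, e₅]
    · rw [m11, l11, k11, j5, j2, j0, h0, i2, i0, hq]
    · have e12 : g₃ 12 = p := by rw [k12, j5, j2, j0, j1, i2, i0, i1, h0, hp]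
      have e6 : g₃ 6 = u := by rw [k6, j6, h2]
      have e7 : g₃ 7 = b := by rw [k7, j7, h3]
      rw [m17, l17, l13, l14, l16, l10, l3, e12, e6, e7, k8, k9, k10, k3, j8, j9, j10, j3, i3,
        h4, h5, h6, ← ha, ← ho, ← hs, ← hr, hc]
  by_cases hcq : c.toNat ≤ q.toNat
  · refine ⟨3 + (10 + 9 + 6 + 11 + 3), by omega, ?_⟩
    rw [Function.iterate_add_apply, hg, if_pos hcq]
    simp [Function.iterate_succ_apply, step, queryProgram, Instr.exec, h11, h17, hcq.not_gt]
  · refine ⟨2 + (10 + 9 + 6 + 11 + 3), by omega, ?_⟩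
    rw [Function.iterate_add_apply, hg, if_neg hcq]
    simp [Function.iterate_succ_apply, step, queryProgram, Instr.exec, h11, h17, not_le.1 hcq]

end WordRAM

/-! ### The memory and the correctness of the rank lookup. -/

namespace WordRAM

/-- The `a`-th word of a bit-vector. -/
def packWord (w : ℕ) (l : List Bool) (a : ℕ) : BitVec w :=
  BitVec.ofFnLE fun t : Fin w => l.getD (a * w + t) false

theorem flatten_map_range_ofFn {α : Type*} (f : ℕ → α) (w W : ℕ) :
    ((List.range W).map fun a => List.ofFn fun t : Fin w => f (a * w + t)).flatten =
      (List.range (W * w)).map f := by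
  induction W with
  | zero => simp
  | succ W ih =>
    rw [List.range_succ, List.map_append, List.flatten_append, ih, add_mul, one_mul,
      List.range_add, List.map_append]
    simp [List.ofFn_eq_map, ← List.map_coe_finRange_eq_range, Function.comp_def]

theorem prefix_bits_packWord {w W : ℕ} {l : List Bool} (h : l.length ≤ W * w) :
    l <+: bits ((List.range W).map (packWord w l)) := by
  have e : bits ((List.range W).map (packWord w l)) =
      (List.range (W * w)).map fun t => l.getD t false := by
    rw [← flatten_map_range_ofFn, bits, List.flatMap_def, List.map_map]
    congr 2
    funext a
    simp [packWord]
  rw [e]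
  have e' : l = (List.range l.length).map fun t => l.getD t false := by
    refine List.ext_getElem (by simp) fun t h1 h2 => ?_
    simp [List.getElem?_eq_getElem h1]
  obtain ⟨s, hs⟩ := Nat.exists_eq_add_of_le h
  rw [hs, List.range_add, List.map_append, ← e']
  exact List.prefix_append _ _

/-- A memory for `queryProgram`: a header, the `W` words of a bit-vector `l`, the ranks of `l` at
every `b`-th bit of each word (`S` of them per word), and the popcounts of all `b`-bit numbers. -/
def rankMemory (w n m b S W : ℕ) (l : List Bool) : List (BitVec w) :=
  ([n, m, w, b, S, 7 + W, 7 + W + W * S].map (BitVec.ofNat w)) ++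
    ((List.range W).map (packWord w l) ++
    ((List.range (W * S)).map (fun q => BitVec.ofNat w (bitRank l (q / S * w + q % S * b))) ++
    (List.range (2 ^ b)).map fun x => BitVec.ofNat w (Nat.count (fun t => x.testBit t = true) b)))

variable {w n m b S W : ℕ} {l : List Bool}

theorem length_rankMemory :
    (rankMemory w n m b S W l).length = 7 + W + W * S + 2 ^ b := by
  simp [rankMemory]
  ring

theorem infix_bits_rankMemory (h : l.length ≤ W * w) :
    l <:+: bits (rankMemory w n m b S W l) := by
  rw [rankMemory, bits, List.flatMap_append, List.flatMap_append, ← List.append_assoc]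
  obtain ⟨s, hs⟩ := prefix_bits_packWord h
  rw [bits] at hs
  rw [← hs]
  exact ⟨_, _, by simp only [List.append_assoc]; rfl⟩

theorem getD_rankMemory_word {a : ℕ} (ha : a < W) :
    (rankMemory w n m b S W l).getD (a + 7) 0 = packWord w l a := by
  rw [rankMemory, List.getD_append_right _ _ _ _ (by simp), List.getD_append _ _ _ _ (by simpa)]
  simp [ha]

theorem getD_rankMemory_sample {q : ℕ} (hq : q < W * S) :
    (rankMemory w n m b S W l).getD (q + (7 + W)) 0 =
      BitVec.ofNat w (bitRank l (q / S * w + q % S * b)) := by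
  rw [rankMemory, List.getD_append_right _ _ _ _ (by simp; omega),
    List.getD_append_right _ _ _ _ (by simp; omega), List.getD_append _ _ _ _ (by simp; omega)]
  have : q + (7 + W) - 7 - W = q := by omega
  simp [this, hq]

theorem getD_rankMemory_popcount {x : ℕ} (hx : x < 2 ^ b) :
    (rankMemory w n m b S W l).getD (x + (7 + W + W * S)) 0 =
      BitVec.ofNat w (Nat.count (fun t => x.testBit t = true) b) := by
  rw [rankMemory, List.getD_append_right _ _ _ _ (by simp; omega),
    List.getD_append_right _ _ _ _ (by simp; omega),
    List.getD_append_right _ _ _ _ (by simp; omega)]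
  have : x + (7 + W + W * S) - 7 - W - W * S = x := by omega
  simp [this, hx]

theorem toNat_ofNat_of_lt {a : ℕ} (h : a < 2 ^ w) : (BitVec.ofNat w a).toNat = a := by
  rw [BitVec.toNat_ofNat, Nat.mod_eq_of_lt h]

theorem ofNat_div {a c : ℕ} (ha : a < 2 ^ w) (hc : c < 2 ^ w) :
    BitVec.ofNat w a / BitVec.ofNat w c = BitVec.ofNat w (a / c) := by
  refine BitVec.eq_of_toNat_eq ?_
  rw [BitVec.toNat_udiv, toNat_ofNat_of_lt ha, toNat_ofNat_of_lt hc,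
    toNat_ofNat_of_lt ((Nat.div_le_self _ _).trans_lt ha)]

theorem ofNat_mod {a c : ℕ} (ha : a < 2 ^ w) (hc : c < 2 ^ w) :
    BitVec.ofNat w a % BitVec.ofNat w c = BitVec.ofNat w (a % c) := by
  refine BitVec.eq_of_toNat_eq ?_
  rw [BitVec.toNat_umod, toNat_ofNat_of_lt ha, toNat_ofNat_of_lt hc,
    toNat_ofNat_of_lt ((Nat.mod_le _ _).trans_lt ha)]

theorem ofNat_sub_ofNat {a c : ℕ} (h : c ≤ a) :
    BitVec.ofNat w a - BitVec.ofNat w c = BitVec.ofNat w (a - c) := by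
  rw [eq_comm]
  refine eq_sub_of_add_eq ?_
  rw [← BitVec.ofNat_add, Nat.sub_add_cancel h]

theorem word_ofNat (D : List (BitVec w)) {a : ℕ} (h : a < 2 ^ w) :
    word D (BitVec.ofNat w a) = D.getD a 0 := by
  rw [word, toNat_ofNat_of_lt h]

/-- The `r` bits of `v` from position `s` on. -/
theorem testBit_shr_and_mask {v : BitVec w} {s r : ℕ} (hr : r < w) (t : ℕ) :
    ((v >>> s) &&& ((1#w <<< r) - 1#w)).toNat.testBit t = (v.getLsbD (s + t) && decide (t < r)) := by
  have hp : 2 ^ r < 2 ^ w := Nat.pow_lt_pow_right (by omega) hr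
  have hr1 : 1 ≤ 2 ^ r := Nat.one_le_two_pow
  have h1 : 1#w <<< r = BitVec.ofNat w (2 ^ r) := by
    refine BitVec.eq_of_toNat_eq ?_
    rw [BitVec.toNat_shiftLeft, toNat_ofNat_of_lt hp,
      toNat_ofNat_of_lt (Nat.one_lt_two_pow (by omega)), Nat.one_shiftLeft, Nat.mod_eq_of_lt hp]
  rw [h1, ofNat_sub_ofNat hr1, BitVec.toNat_and, Nat.testBit_and,
    toNat_ofNat_of_lt (by omega), Nat.testBit_two_pow_sub_one, BitVec.toNat_ushiftRight,
    Nat.testBit_shiftRight, BitVec.getLsbD]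

theorem count_congr {p q : ℕ → Prop} [DecidablePred p] [DecidablePred q] {N : ℕ}
    (h : ∀ t < N, p t ↔ q t) : Nat.count p N = Nat.count q N :=
  le_antisymm (Nat.count_mono_left fun t ht => (h t ht).1)
    (Nat.count_mono_left fun t ht => (h t ht).2)

/-- Write `p = a * w + s * b + r` with `r < b`. The sample counts the ones before `a * w + s * b`;
shift and mask isolate the next `r` bits as an index into the popcount table. The hypothesis `hS`
gives `s < S`, and `hlen` keeps addresses from wrapping around. -/
theorem word_add_word_rankMemory {p a o s r : ℕ} (hp : p < W * w)
    (hlen : 7 + W + W * S + 2 ^ b ≤ 2 ^ w) (hb : 0 < b) (hS : w < b * S)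
    (ha : a = p / w) (ho : o = p % w) (hs : s = o / b) (hr : r = o % b) :
    word (rankMemory w n m b S W l)
        (BitVec.ofNat w a * BitVec.ofNat w S + BitVec.ofNat w s + BitVec.ofNat w (7 + W)) +
      word (rankMemory w n m b S W l)
        (((word (rankMemory w n m b S W l) (BitVec.ofNat w a + 7#w) >>> (o - r)) &&&
          ((1#w <<< r) - 1#w)) + BitVec.ofNat w (7 + W + W * S)) =
      BitVec.ofNat w (bitRank l p) := by
  have hw : 0 < w := Nat.pos_of_ne_zero fun h => by simp [h] at hp
  have haW : a < W := by rw [ha]; exact Nat.div_lt_of_lt_mul (by rwa [mul_comm])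
  have how : o < w := by rw [ho]; exact Nat.mod_lt _ hw
  have hsS : s < S := by
    rw [hs]; exact Nat.div_lt_of_lt_mul (how.trans hS)
  have hrb : r < b := by rw [hr]; exact Nat.mod_lt _ hb
  have hbw : b ≤ w := (Nat.pow_le_pow_iff_right (a := 2) (by omega)).1 (by omega)
  have hos : b * s + r = o := by rw [hs, hr]; exact Nat.div_add_mod _ _
  have hpo : a * w + o = p := by rw [ha, ho]; exact Nat.div_add_mod' _ _
  have hq : a * S + s < W * S := by nlinarith
  have hb2 := Nat.one_le_two_pow (n := b)
  have hqS : (a * S + s) / S = a := by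
    rw [mul_comm, Nat.mul_add_div (by omega), Nat.div_eq_of_lt hsS, add_zero]
  have hqS' : (a * S + s) % S = s := by
    rw [mul_comm, Nat.mul_add_mod, Nat.mod_eq_of_lt hsS]
  rw [← BitVec.ofNat_mul, ← BitVec.ofNat_add, ← BitVec.ofNat_add, ← BitVec.ofNat_add,
    word_ofNat _ (by omega), word_ofNat _ (by omega), getD_rankMemory_sample hq, hqS, hqS',
    getD_rankMemory_word haW]
  set y := ((packWord w l a >>> (o - r)) &&& ((1#w <<< r) - 1#w)) with hy
  have hbit : ∀ t, y.toNat.testBit t =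
      (l.getD (a * w + s * b + t) false && decide (t < r)) := by
    intro t
    rw [hy, testBit_shr_and_mask (by omega)]
    by_cases ht : t < r
    · rw [packWord, BitVec.getLsbD_ofFnLE, dif_pos (by omega)]
      congr 2
      rw [mul_comm s b]
      simp only
      omega
    · simp [ht]
  have hylt : y.toNat < 2 ^ b := by
    refine Nat.lt_pow_two_of_testBit _ fun t ht => ?_
    rw [hbit]
    simp
    omega
  have hye : y = BitVec.ofNat w y.toNat := by simp
  rw [hye, ← BitVec.ofNat_add, word_ofNat _ (by omega), getD_rankMemory_popcount hylt,
    ← BitVec.ofNat_add]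
  congr 1
  -- The table counts `b` bits; those from `r` on have been masked to zero.
  obtain ⟨b', rfl⟩ := Nat.exists_eq_add_of_le hrb.le
  rw [Nat.count_add]
  have h0 : Nat.count (fun t => y.toNat.testBit (r + t) = true) b' = 0 := by
    rw [Nat.count_iff_forall_not]
    intro t _
    simp [hbit]
  have h1 : Nat.count (fun t => y.toNat.testBit t = true) r =
      Nat.count (fun t => l.getD (a * w + s * (r + b') + t) false = true) r := by
    refine count_congr fun t ht => ?_
    simp [hbit, ht]
  rw [h0, h1, add_zero, bitRank, ← Nat.count_add, bitRank]
  congr 1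
  rw [← hpo, ← hos]
  ring

end WordRAM

/-! ### Space and overflow bounds. -/

namespace WordRAM

/-- The unused half of the exponent absorbs the factor `L`. This bounds the popcount table, as `2 ^
(L - 1) ≤ N`. -/
theorem two_pow_half_mul_le {L : ℕ} (hL : 0 < L) : 2 ^ (L / 2 + 1) * L ≤ 4 * 2 ^ (L - 1) := by
  obtain ⟨u, hu⟩ : ∃ u, L - L / 2 = u + 1 := ⟨L - L / 2 - 1, by omega⟩
  have h1 : L ≤ 2 * 2 ^ u := by
    have := Nat.lt_two_pow_self (n := u)
    omega
  calc 2 ^ (L / 2 + 1) * L ≤ 2 ^ (L / 2 + 1) * (2 * 2 ^ u) := Nat.mul_le_mul_left _ h1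
    _ = 4 * 2 ^ (L / 2 + u) := by ring
    _ = 4 * 2 ^ (L - 1) := by congr 2; omega

/-- The four summands of the constant pay for the header, the bit-vector, the samples and the
popcount table. -/
theorem length_rankMemory_mul_le {N w c L b S W : ℕ} (hN : 0 < N) (hL : L = Nat.log 2 N + 1)
    (hwc : w ≤ c * L) (hb : b = L / 2 + 1) (hS : S = w / b + 1) (hW : W = 2 * N / w + 1) :
    (7 + W + W * S + 2 ^ b) * w ≤ (7 * c + (c + 2) + (c + 2) * (2 * c + 1) + 4 * c) * N := by
  have hpow : 2 ^ (L - 1) ≤ N := by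
    rw [hL]; exact Nat.pow_log_le_self 2 hN.ne'
  have hLN : L ≤ N := by
    have := Nat.lt_two_pow_self (n := L - 1)
    omega
  have hwN : w ≤ c * N := hwc.trans (Nat.mul_le_mul_left _ hLN)
  have hS' : S ≤ 2 * c + 1 := by
    have : w / b ≤ 2 * c := by
      refine Nat.div_le_of_le_mul (hwc.trans ?_)
      have : L ≤ 2 * b := by omega
      nlinarith
    omega
  have hW' : W * w ≤ (c + 2) * N := by
    have := Nat.div_mul_le_self (2 * N) w
    rw [hW]
    nlinarith
  have hWS : W * S * w ≤ (c + 2) * (2 * c + 1) * N := by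
    calc W * S * w = (W * w) * S := by ring
      _ ≤ ((c + 2) * N) * (2 * c + 1) := Nat.mul_le_mul hW' hS'
      _ = _ := by ring
  have hb' : 2 ^ b * w ≤ 4 * c * N := by
    calc 2 ^ b * w ≤ 2 ^ b * (c * L) := Nat.mul_le_mul_left _ hwc
      _ = c * (2 ^ (L / 2 + 1) * L) := by rw [hb]; ring
      _ ≤ c * (4 * 2 ^ (L - 1)) := Nat.mul_le_mul_left _ (two_pow_half_mul_le (by omega))
      _ ≤ c * (4 * N) := by gcongr
      _ = _ := by ring
  linarith [add_mul (7 + W + W * S) (2 ^ b) w, add_mul (7 + W) (W * S) w, add_mul 7 W w,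
    add_mul (7 * c + (c + 2) + (c + 2) * (2 * c + 1)) (4 * c) N]

/-- Ten bits beyond `L` leave room for all addresses, and for positions and ranks, which are below
`2 * N`. -/
theorem length_rankMemory_le_two_pow {N w L b S W : ℕ} (hL : L = Nat.log 2 N + 1)
    (hw : L + 10 ≤ w) (hb : b = L / 2 + 1) (hS : S = w / b + 1) (hW : W = 2 * N / w + 1) :
    7 + W + W * S + 2 ^ b ≤ 2 ^ w ∧ 4 * N < 2 ^ w := by
  have hNL : N < 2 ^ L := by rw [hL]; exact Nat.lt_pow_succ_log_self (by omega) _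
  obtain ⟨v, rfl⟩ := Nat.exists_eq_add_of_le' (show 10 ≤ w by omega)
  have hLv : 2 ^ L ≤ 2 ^ v := Nat.pow_le_pow_right (by omega) (by omega)
  have hbv : 2 ^ b ≤ 2 ^ v := Nat.pow_le_pow_right (by omega) (by omega)
  have hv := Nat.lt_two_pow_self (n := v)
  have hS' : S ≤ (v + 10) + 1 := by
    have := Nat.div_le_self (v + 10) b
    omega
  have hW' : W ≤ 2 * N + 1 := by
    have := Nat.div_le_self (2 * N) (v + 10)
    omega
  have hWw : W * (v + 10) ≤ 2 * N + (v + 10) := by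
    have := Nat.div_mul_le_self (2 * N) (v + 10)
    rw [hW, add_mul]
    omega
  have hWS : W * S ≤ W * (v + 10) + W := by
    calc W * S ≤ W * ((v + 10) + 1) := Nat.mul_le_mul_left _ hS'
      _ = _ := by ring
  rw [pow_add]
  omega

end WordRAM

theorem mainTheorem11 :
    ∃ (P : WordRAM.Program) (T d : ℕ), ∀ c : ℕ, ∃ C : ℕ, ∀ n m w : ℕ,
      Nat.log 2 (n * m) + 1 + d ≤ w → w ≤ c * (Nat.log 2 (n * m) + 1) →
      ∀ A : Fin n → Fin n → ℕ, IMS2 n m A →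
        ∃ D : List (BitVec w),
          D.length * w ≤ C * (n * m) ∧
          (List.ofFn fun k : Fin m => IMS2.boundaryCode A k).flatten <:+: WordRAM.bits D ∧
          ∀ (i j : Fin n) (k : BitVec w),
            WordRAM.Answers P T D (BitVec.ofNat w i) (BitVec.ofNat w j) k
              (if k.toNat ≤ A i j then 1#w else 0#w) := by
  refine ⟨WordRAM.queryProgram, 45, 10, fun c =>
    ⟨7 * c + (c + 2) + (c + 2) * (2 * c + 1) + 4 * c, fun n m w hw hwc A hA => ?_⟩⟩
  -- For `n = 0` no space is allowed, but there are no bits to store and no queries.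
  rcases Nat.eq_zero_or_pos n with rfl | hn
  · refine ⟨[], by simp, ?_, fun i => i.elim0⟩
    have : IMS2.allCodes m A = [] := List.length_eq_zero_iff.1 (by simp [IMS2.length_allCodes])
    exact (congrArg (· <:+: _) this).mpr (List.nil_infix)
  have hm : 0 < m := (Nat.zero_le _).trans_lt (hA.lt ⟨0, hn⟩ ⟨0, hn⟩)
  have hN : 0 < n * m := Nat.mul_pos hn hm
  obtain ⟨L, hL⟩ : ∃ L, L = Nat.log 2 (n * m) + 1 := ⟨_, rfl⟩
  obtain ⟨b, hb⟩ : ∃ b, b = L / 2 + 1 := ⟨_, rfl⟩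
  obtain ⟨S, hS⟩ : ∃ S, S = w / b + 1 := ⟨_, rfl⟩
  obtain ⟨W, hW⟩ : ∃ W, W = 2 * (n * m) / w + 1 := ⟨_, rfl⟩
  rw [← hL] at hw hwc
  obtain ⟨hlen, h4⟩ := WordRAM.length_rankMemory_le_two_pow hL hw hb hS hW
  have hWw : 2 * (n * m) < W * w := by
    rw [hW, mul_comm _ w]; exact Nat.lt_mul_div_succ _ (by omega)
  have hbS : w < b * S := by
    rw [hS]; exact Nat.lt_mul_div_succ _ (by omega)
  refine ⟨WordRAM.rankMemory w n m b S W (IMS2.allCodes m A), ?_, ?_, fun i j z => ?_⟩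
  · rw [WordRAM.length_rankMemory]
    exact WordRAM.length_rankMemory_mul_le hN hL hwc hb hS hW
  · refine WordRAM.infix_bits_rankMemory (l := IMS2.allCodes m A) ?_
    rw [IMS2.length_allCodes, mul_assoc]
    exact hWw.le
  have hw2 : w < 2 ^ w := Nat.lt_two_pow_self
  have hnN : n ≤ n * m := Nat.le_mul_of_pos_right _ hm
  have hmN : m ≤ n * m := Nat.le_mul_of_pos_left _ hn
  have hm' : (BitVec.ofNat w m).toNat = m := WordRAM.toNat_ofNat_of_lt (by omega)
  rcases le_or_gt m z.toNat with hz | hz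
  · rw [if_neg (not_le.2 ((hA.lt i j).trans_le hz))]
    exact WordRAM.answers_of_le (m := BitVec.ofNat w m) _ (by omega) rfl (by rwa [hm'])
  have hzn : n * z.toNat + n ≤ n * m := by
    rw [← Nat.mul_succ]; exact Nat.mul_le_mul_left _ hz
  have hi := i.2
  have hj := j.2
  -- The position in the concatenation at which the boundary meets the diagonal through entry `(i,
  -- j)`.
  obtain ⟨p, hp⟩ : ∃ p, p = 2 * n * z.toNat + (n + i - j) := ⟨_, rfl⟩
  have hp' : p = n * z.toNat + n * z.toNat + n + i - j := by
    rw [hp, mul_assoc, two_mul]; omega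
  have hpN : p < 2 * (n * m) := by omega
  have how : p % w < w := Nat.mod_lt _ (by omega)
  have hbw : b < 2 ^ w := by omega
  have hq : BitVec.ofNat w (n * z.toNat + i) = BitVec.ofNat w n * z + BitVec.ofNat w i := by
    rw [BitVec.ofNat_add, BitVec.ofNat_mul, BitVec.ofNat_toNat, BitVec.setWidth_eq]
  have hpz : BitVec.ofNat w p = BitVec.ofNat w n * z + BitVec.ofNat w n * z + BitVec.ofNat w n +
      BitVec.ofNat w i - BitVec.ofNat w j := by
    rw [hp', ← WordRAM.ofNat_sub_ofNat (by omega), BitVec.ofNat_add, BitVec.ofNat_add,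
      BitVec.ofNat_add, BitVec.ofNat_mul, BitVec.ofNat_toNat, BitVec.setWidth_eq]
  have hrank := WordRAM.word_add_word_rankMemory (n := n) (m := m) (l := IMS2.allCodes m A)
    (hpN.trans hWw) hlen (by omega) hbS rfl rfl rfl rfl
  have key := WordRAM.answers_of_lt (WordRAM.rankMemory w n m b S W (IMS2.allCodes m A))
    (m := BitVec.ofNat w m) (u := BitVec.ofNat w w) (S := BitVec.ofNat w S)
    (R := BitVec.ofNat w (7 + W)) (Q := BitVec.ofNat w (7 + W + W * S)) (by omega)
    rfl rfl rfl rfl rfl rfl rfl (by rwa [hm']) hq hpz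
    (WordRAM.ofNat_div (by omega) hw2).symm (WordRAM.ofNat_mod (by omega) hw2).symm
    (WordRAM.ofNat_div (by omega) hbw).symm (WordRAM.ofNat_mod (by omega) hbw).symm
    (c := BitVec.ofNat w (bitRank (IMS2.allCodes m A) p)) (by
      have := Nat.mod_le (p % w) b
      rw [← hrank, WordRAM.ofNat_sub_ofNat this, WordRAM.toNat_ofNat_of_lt (by omega),
        WordRAM.toNat_ofNat_of_lt (by omega)])
  -- Neither side of the machine's final comparison wraps around, so it compares the true rank with
  -- `n * z + i`.
  have hle : bitRank (IMS2.allCodes m A) p ≤ p := Nat.count_le _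
  have hiff : (BitVec.ofNat w (bitRank (IMS2.allCodes m A) p)).toNat ≤
      (BitVec.ofNat w (n * z.toNat + i)).toNat ↔ z.toNat ≤ A i j := by
    rw [WordRAM.toNat_ofNat_of_lt (by omega), WordRAM.toNat_ofNat_of_lt (by omega), hp,
      IMS2.bitRank_allCodes hA hz (by omega), Nat.add_le_add_iff_left,
      IMS2.le_iff_bitRank_boundaryCode_le hA]
  simpa only [hiff] using key
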